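/- Conventions. An indexed forest is a sequence $F=(T_1,T_2,\ldots)$ of binary plane trees (every node has either no child, a leaf, or exactly two children, an internal node), all but finitely many equal to the one-node tree; $\emptyset$ is the forest all of whose trees are one-node trees. The leaves of $F$ are numbered $1,2,3,\ldots$ from left to right, and $\operatorname{supp}(F)$ is the set of leaves of the trees of $F$ that have an internal node. For an internal node $v$ with children $v_L,v_R$, the canonical label of $v$ is the number of the rightmost leaf descendant of $v_L$, and $\rho_F(v)$ is the number of the leftmost leaf descendant of $v$; $v$ is terminal if $v_L,v_R$ are leaves. Put $\operatorname{Qdes}(F)=\{\rho_F(v) : v \text{ terminal}\}$ and, for $i\in\operatorname{Qdes}(F)$, let $F/i$ be the forest obtained by replacing the terminal node $v$ with $\rho_F(v)=i$ by a leaf. A Sylvester word of $F$ is a word listing the canonical label of each internal node of $F$ exactly once, such that the label of each internal node appears before the labels of those of its children that are internal. For $f(\mathbf x;\mathbf t)\in\mathbb Z[\mathbf t][\mathbf x]$, with $\mathbf x=(x_1,x_2,\ldots)$ and $\mathbf t=(t_1,t_2,\ldots)$, and $i\ge 1$ let $$E_if=\frac{f(x_1,\ldots,x_{i-1},x_i,t_i,x_{i+1},\ldots;\mathbf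 t)-f(x_1,\ldots,x_{i-1},t_i,x_i,x_{i+1},\ldots;\mathbf t)}{x_i-t_i}\in\mathbb Z[\mathbf t][\mathbf x],$$ and let $\widehat{\mathbf t}_i=(t_1,\ldots,t_{i-1},t_{i+1},\ldots)$. Theorem. (1) There is a unique family of polynomials $\mathfrak P_F(\mathbf x;\mathbf t)\in\mathbb Z[\mathbf t][\mathbf x]$, indexed by all indexed forests $F$, each homogeneous (for the total degree in $\mathbf x$ and $\mathbf t$ together), such that for all $F$ and all $i\ge 1$ $$\mathfrak P_F(\mathbf t;\mathbf t)=\begin{cases}1&F=\emptyset\\0&\text{otherwise}\end{cases}\qquad\text{and}\qquad E_i\mathfrak P_F=\begin{cases}\mathfrak P_{F/i}(\mathbf x;\widehat{\mathbf t}_i)& i\in\operatorname{Qdes}(F)\\0&\text{otherwise.}\end{cases}$$ (2) Let $n\ge 0$. For $1\le k\le n$ let $\omega^{(k)}_{[n]}=(n,n-1,\ldots,k+1,k,\overline{k+1},\ldots,\overline{n-1},\overline n)$, let $\widetilde\omega_{[n]}=\omega^{(1)}_{[n]}\omega^{(2)}_{[n]}\cdots\omega^{(n)}_{[n]}$ be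 the concatenation, and give the unbarred letter $j$ of $\omega^{(k)}_{[n]}$ the weight $x_k-t_j$ and the barred letter $\overline j$ of $\omega^{(k)}_{[n]}$ the weight $t_j-t_k$. If $\operatorname{supp}(F)\subseteq\{1,\ldots,n+1\}$, then $$\mathfrak P_F(\mathbf x;\mathbf t)=\sum_{\pi}\operatorname{wt}(\pi),$$ where $\pi$ runs over the subwords of $\widetilde\omega_{[n]}$ (sets of positions) whose letters, read from left to right with bars ignored, form a Sylvester word of $F$, and $\operatorname{wt}(\pi)$ is the product of the weights of the letters of $\pi$. -/

import Mathlib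

/-! All index sets are shifted by one: the positive integers `1, 2, 3, …` labelling variables,
trees, leaves, letters, syllables and operators are represented by `0, 1, 2, … : ℕ`. -/

namespace DoubleForest

open MvPolynomial

/-! ### Indexed forests -/

/-- A binary plane tree: `nil` is a leaf, `node () l r` an internal node with two children. -/
abbrev PlaneTree : Type := BinaryTree Unit

/-- An indexed forest: a sequence of binary plane trees, all but finitely many of them trivial. -/
@[ext]
structure IndexedForest where
  tree : ℕ → PlaneTree
  finite_nontrivial : {k | tree k ≠ BinaryTree.nil}.Finite

/-- An internal node, recorded by its leftmost leaf descendant (the flag `ρ`, reached by going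
down left edges) and the subtrees hanging from its left and right children. -/
@[ext]
structure Vertex where
  flag : ℕ
  left : PlaneTree
  right : PlaneTree

/-- The canonical label: the rightmost leaf of the left subtree. That subtree has
`left.numNodes + 1` leaves, the first of which is `flag`. -/
def Vertex.label (v : Vertex) : ℕ := v.flag + v.left.numNodes

/-- Both children are leaves. -/
def Vertex.IsTerminal (v : Vertex) : Prop :=
  v.left = BinaryTree.nil ∧ v.right = BinaryTree.nil

/-- The subtree rooted at `v`. -/
def Vertex.subtree (v : Vertex) : PlaneTree := BinaryTree.node () v.left v.right

/-- `u` is the left or the right child of `v`. -/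
def Vertex.IsChildOf (u v : Vertex) : Prop :=
  (u.flag = v.flag ∧ u.subtree = v.left) ∨
    (u.flag = v.flag + v.left.numLeaves ∧ u.subtree = v.right)

/-- The internal nodes of a tree whose leaves are numbered `s, s + 1, …` from left to right. -/
def internalNodes : ℕ → PlaneTree → List Vertex
  | _, BinaryTree.nil => []
  | s, BinaryTree.node _ l r =>
      ⟨s, l, r⟩ :: (internalNodes s l ++ internalNodes (s + l.numLeaves) r)

/-- Replace the terminal node with flag `i`, if there is one, by a leaf, in a tree whose leaves
are numbered `s, s + 1, …` from left to right. -/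
def trimTree (i : ℕ) : ℕ → PlaneTree → PlaneTree
  | _, BinaryTree.nil => BinaryTree.nil
  | s, BinaryTree.node _ l r =>
      if l = BinaryTree.nil ∧ r = BinaryTree.nil ∧ s = i then BinaryTree.nil
      else BinaryTree.node () (trimTree i s l) (trimTree i (s + l.numLeaves) r)

namespace IndexedForest

/-- The empty forest, all of whose trees are trivial. -/
def empty : IndexedForest where
  tree := fun _ => BinaryTree.nil
  finite_nontrivial := by simp

/-- The number of the first leaf of the `k`-th tree. -/
def start (F : IndexedForest) (k : ℕ) : ℕ := ∑ j ∈ Finset.range k, (F.tree j).numLeaves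

/-- The set of internal nodes of `F`. -/
def internal (F : IndexedForest) : Set Vertex :=
  {v | ∃ k, v ∈ internalNodes (F.start k) (F.tree k)}

/-- The set of leaves of nontrivial trees of `F`. -/
def support (F : IndexedForest) : Set ℕ :=
  {m | ∃ k, F.tree k ≠ BinaryTree.nil ∧ F.start k ≤ m ∧ m < F.start k + (F.tree k).numLeaves}

/-- The set of flags of the terminal nodes. -/
def qdes (F : IndexedForest) : Set ℕ :=
  {i | ∃ v ∈ F.internal, v.IsTerminal ∧ v.flag = i}

/-- The trimmed forest `F / i`, used only for `i ∈ F.qdes`: delete the terminal node with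
flag `i`. -/
def trim (F : IndexedForest) (i : ℕ) : IndexedForest where
  tree := fun k => trimTree i (F.start k) (F.tree k)
  finite_nontrivial := by
    refine F.finite_nontrivial.subset fun k hk h => hk ?_
    simp [h, trimTree]

/-- The Sylvester words of `F`: the canonical labels of the internal nodes of `F`, each written
exactly once, the label of a node coming before the labels of its children. -/
def sylvester (F : IndexedForest) : Set (List ℕ) :=
  {w | w.Nodup ∧ (∀ a, a ∈ w ↔ ∃ v ∈ F.internal, v.label = a) ∧
    ∀ u ∈ F.internal, ∀ v ∈ F.internal, u.IsChildOf v → w.idxOf v.label < w.idxOf u.label}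

end IndexedForest

/-! ### Polynomials and operators -/

/-- The ring `ℤ[t][x]`, as polynomials over `ℤ` in the variables `x` and `t` together, so that
homogeneity refers to the total degree in both sets of variables. -/
abbrev Pol : Type := MvPolynomial (ℕ ⊕ ℕ) ℤ

noncomputable def x (i : ℕ) : Pol := X (Sum.inl i)

noncomputable def t (i : ℕ) : Pol := X (Sum.inr i)

/-- The substitution `f(a; b)`. -/
noncomputable def subst (a b : ℕ → Pol) : Pol →ₐ[ℤ] Pol := aeval (Sum.elim a b)

/-- `f(x_1, …, x_{i-1}, t_i, x_i, x_{i+1}, …; t)`. -/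
noncomputable def ropeMinus (i : ℕ) : Pol →ₐ[ℤ] Pol :=
  subst (fun j => if j < i then x j else if j = i then t i else x (j - 1)) t

/-- `f(x_1, …, x_{i-1}, x_i, t_i, x_{i+1}, …; t)`. -/
noncomputable def ropePlus (i : ℕ) : Pol →ₐ[ℤ] Pol :=
  subst (fun j => if j ≤ i then x j else if j = i + 1 then t i else x (j - 1)) t

theorem dvd_ropePlus_sub_ropeMinus (i : ℕ) (f : Pol) :
    x i - t i ∣ ropePlus i f - ropeMinus i f := by
  rw [← Ideal.mem_span_singleton, ← Ideal.Quotient.mk_eq_mk_iff_sub_mem]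
  have hxt : Ideal.Quotient.mk (Ideal.span {x i - t i}) (x i) =
      Ideal.Quotient.mk (Ideal.span {x i - t i}) (t i) := by
    rw [Ideal.Quotient.mk_eq_mk_iff_sub_mem]
    exact Ideal.mem_span_singleton_self _
  have h : (Ideal.Quotient.mkₐ ℤ (Ideal.span {x i - t i})).comp (ropePlus i) =
      (Ideal.Quotient.mkₐ ℤ (Ideal.span {x i - t i})).comp (ropeMinus i) := by
    apply MvPolynomial.algHom_ext
    rintro (j | j)
    · simp only [ropePlus, ropeMinus, subst, AlgHom.comp_apply, aeval_X, Sum.elim_inl,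
        Ideal.Quotient.mkₐ_eq_mk]
      rcases lt_trichotomy j i with h | h | h
      · rw [if_pos h.le, if_pos h]
      · subst h
        simpa using hxt
      · have h1 : ¬ j ≤ i := by omega
        have h2 : ¬ j < i := by omega
        have h3 : ¬ j = i := by omega
        rw [if_neg h1, if_neg h2, if_neg h3]
        by_cases h' : j = i + 1
        · subst h'
          simp [hxt]
        · rw [if_neg h']
    · simp [ropePlus, ropeMinus, subst]
  exact DFunLike.congr_fun h f

/-- The equivariant trimming operation: the exact quotient of `ropePlus i f - ropeMinus i f`
by `x_i - t_i`. -/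
noncomputable def eope (i : ℕ) (f : Pol) : Pol :=
  Classical.choose (dvd_ropePlus_sub_ropeMinus i f)

theorem mul_eope (i : ℕ) (f : Pol) :
    (x i - t i) * eope i f = ropePlus i f - ropeMinus i f :=
  (Classical.choose_spec (dvd_ropePlus_sub_ropeMinus i f)).symm

/-- The sequence `t` with its `i`-th entry omitted. -/
noncomputable def tHat (i : ℕ) : ℕ → Pol := fun j => if j < i then t j else t (j + 1)

open Classical in
/-- The defining properties of the family of double forest polynomials. -/
structure IsDoubleForestFamily (P : IndexedForest → Pol) : Prop where
  homogeneous : ∀ F, ∃ d, (P F).IsHomogeneous d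
  normalized : ∀ F, subst t t (P F) = if F = IndexedForest.empty then 1 else 0
  recursion : ∀ F i,
    eope i (P F) = if i ∈ F.qdes then subst x (tHat i) (P (F.trim i)) else 0

/-! ### The vine subword model -/

open Classical in
/-- The subword generating function of a set `D` of words in a word `ω`, whose letters carry a
value and a weight. `ω.sublists` runs over the subsets of positions of `ω`. -/
noncomputable def subwordSum {α : Type} (value : α → ℕ) (weight : α → Pol) (ω : List α)
    (D : Set (List ℕ)) : Pol :=
  ((ω.sublists.filter fun π => π.map value ∈ D).map fun π => (π.map weight).prod).sum

/-- A letter of the long word, unbarred or barred. -/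
structure Letter where
  value : ℕ
  syllable : ℕ
  barred : Bool

/-- The `k`-th syllable `n, n-1, …, k+1, k, \overline{k+1}, …, \overline{n}`. -/
def syllable (n k : ℕ) : List Letter :=
  (List.Ico k n).reverse.map (fun j => ⟨j, k, false⟩) ++
    (List.Ico (k + 1) n).map (fun j => ⟨j, k, true⟩)

/-- The long word: the concatenation of the `n` syllables. -/
def longWord (n : ℕ) : List Letter := (List.range n).flatMap (syllable n)

/-- The unbarred letter `j` in the `i`-th syllable has weight `x_i - t_j`, the barred one
`t_j - t_i`. -/
noncomputable def letterWeight (a : Letter) : Pol :=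
  if a.barred then t a.value - t a.syllable else x a.syllable - t a.value

end DoubleForest

namespace DoubleForest

/-! ### Spans of internal nodes -/

/-! Uniqueness. A polynomial `f` killed by every `E_i` and with `f(t;t) = 0` vanishes
(`eq_zero_of_eope_eq_zero`): if `x_k` is its last variable, `E_k f = 0` says that `f` does not
change under `x_k = t_k`, so the variables can be removed one at a time. Trimming lowers the bound
on the support, so the recursion determines the family by induction on that bound.

Existence. The subword sums satisfy the recursion. Sylvester words have no repeated letter, so two
adjacent letters of equal value and opposite weights can be struck out of the long word
(`wordSum_cancel_pair`). At `x_k = t_k` the `k`-th syllable therefore disappears, which gives the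
normalization. For the same reason `ropeMinus i` deletes the `i`-th syllable, while under `ropePlus
i` the barred half of syllable `i` cancels the unbarred half of syllable `i + 1`. The two remaining
words differ by one letter `i` of weight `x_i - t_i`, after which all letters are at least `i + 2`;
so `E_i` extracts that letter (`eope_wordSum`).

The labels in the subtree of a node form an interval from its flag to its last label, and the
Sylvester condition says that the label of the node comes first among them. Hence `u i v` with all
letters of `v` at least `i + 2` can be Sylvester only if `i` is the label of a terminal node, and
removing `i` and closing the gap then gives exactly the Sylvester words of `F / i`
(`insert_mem_sylvester_iff`). The same relabelling turns the trimmed word into the next smaller long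
word with `t_i` omitted (`filter_trimmedWord`). -/

/-- The last label in the subtree rooted at `v`. -/
def Vertex.last (v : Vertex) : ℕ := v.flag + v.left.numNodes + v.right.numNodes

/-- The triples (flag, label, last label of the subtree) of the internal nodes of a tree whose
leaves are numbered `s, s + 1, …`. -/
def treeSpans : ℕ → PlaneTree → Set (ℕ × ℕ × ℕ)
  | _, BinaryTree.nil => ∅
  | s, BinaryTree.node _ l r =>
      insert (s, s + l.numNodes, s + l.numNodes + r.numNodes)
        (treeSpans s l ∪ treeSpans (s + l.numNodes + 1) r)

theorem mem_treeSpans_iff (s : ℕ) (T : PlaneTree) (p : ℕ × ℕ × ℕ) :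
    p ∈ treeSpans s T ↔ ∃ v ∈ internalNodes s T, (v.flag, v.label, v.last) = p := by
  induction T generalizing s with
  | nil => simp [treeSpans, internalNodes]
  | node _ l r ihl ihr =>
    simp only [treeSpans, internalNodes, Set.mem_insert_iff, Set.mem_union, ihl, ihr,
      List.mem_cons, List.mem_append, BinaryTree.numLeaves_eq_numNodes_succ, ← add_assoc,
      or_and_right, exists_or, exists_eq_left]
    simp [Vertex.label, Vertex.last, eq_comm]

theorem treeSpans_bounds {s : ℕ} {T : PlaneTree} {a b c : ℕ} (h : (a, b, c) ∈ treeSpans s T) :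
    s ≤ a ∧ a ≤ b ∧ b ≤ c ∧ c < s + T.numNodes := by
  induction T generalizing s with
  | nil => simp [treeSpans] at h
  | node _ l r ihl ihr =>
    simp only [treeSpans, Set.mem_insert_iff, Set.mem_union, Prod.mk.injEq] at h
    simp only [BinaryTree.numNodes]
    rcases h with h | h | h
    · omega
    · have := ihl h; omega
    · have := ihr h; omega

/-- Canonical labels number the nodes in infix order: left subtree, root, right subtree occupy
consecutive intervals. -/
theorem exists_mem_treeSpans_label {s : ℕ} {T : PlaneTree} {d : ℕ} (h₁ : s ≤ d)
    (h₂ : d < s + T.numNodes) : ∃ p ∈ treeSpans s T, p.2.1 = d := by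
  induction T generalizing s with
  | nil => simp [BinaryTree.numNodes] at h₂; omega
  | node _ l r ihl ihr =>
    simp only [BinaryTree.numNodes] at h₂
    simp only [treeSpans]
    rcases lt_trichotomy d (s + l.numNodes) with h | h | h
    · obtain ⟨p, hp, e⟩ := ihl h₁ h
      exact ⟨p, by simp [hp], e⟩
    · exact ⟨_, Set.mem_insert _ _, h.symm⟩
    · obtain ⟨p, hp, e⟩ := ihr (s := s + l.numNodes + 1) (by omega) (by omega)
      exact ⟨p, by simp [hp], e⟩

theorem treeSpans_label_mem {s : ℕ} {T : PlaneTree} {a b c d : ℕ} (h : (a, b, c) ∈ treeSpans s T)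
    (h₁ : a ≤ d) (h₂ : d ≤ c) : ∃ p ∈ treeSpans s T, p.2.1 = d := by
  have := treeSpans_bounds h
  exact exists_mem_treeSpans_label (by omega) (by omega)

/-- The effect on the span of a node of splitting the leaf `i` into two. -/
def splitSpan (i : ℕ) (p : ℕ × ℕ × ℕ) : ℕ × ℕ × ℕ :=
  -- The boundary cases differ: the left half of the split leaf keeps the number `i`, so a flag
  -- equal to `i` stays, but a rightmost leaf equal to `i` becomes `i + 1`. The label is such a
  -- rightmost leaf; the last label is one less than one.
  (if p.1 ≤ i then p.1 else p.1 + 1, if p.2.1 < i then p.2.1 else p.2.1 + 1,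
    if p.2.2 + 1 < i then p.2.2 else p.2.2 + 1)

theorem treeSpans_succ (s : ℕ) (T : PlaneTree) :
    treeSpans (s + 1) T = (fun p : ℕ × ℕ × ℕ => (p.1 + 1, p.2.1 + 1, p.2.2 + 1)) ''
      treeSpans s T := by
  induction T generalizing s with
  | nil => simp [treeSpans]
  | node _ l r ihl ihr =>
    simp only [treeSpans, Set.image_insert_eq, Set.image_union, ← ihl, ← ihr]
    congr 3 <;> omega

theorem splitSpan_image_of_lt {i s : ℕ} (T : PlaneTree) (h : i < s) :
    splitSpan i '' treeSpans s T = treeSpans (s + 1) T := by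
  rw [treeSpans_succ]
  apply Set.image_congr
  rintro ⟨a, b, c⟩ hp
  have := treeSpans_bounds hp
  simp only [splitSpan, Prod.mk.injEq]
  refine ⟨if_neg ?_, if_neg ?_, if_neg ?_⟩ <;> omega

theorem splitSpan_image_of_gt {i s : ℕ} (T : PlaneTree) (h : s + T.numNodes < i) :
    splitSpan i '' treeSpans s T = treeSpans s T := by
  conv_rhs => rw [← Set.image_id (treeSpans s T)]
  apply Set.image_congr
  rintro ⟨a, b, c⟩ hp
  have := treeSpans_bounds hp
  simp only [splitSpan, Prod.mk.injEq, id]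
  refine ⟨if_pos ?_, if_pos ?_, if_pos ?_⟩ <;> omega

theorem trimTree_eq_self {i s : ℕ} {T : PlaneTree} (h : i < s ∨ s + T.numNodes ≤ i) :
    trimTree i s T = T := by
  induction T generalizing s with
  | nil => rfl
  | node _ l r ihl ihr =>
    simp only [BinaryTree.numNodes] at h
    have hn : ¬ (l = BinaryTree.nil ∧ r = BinaryTree.nil ∧ s = i) := by
      rintro ⟨rfl, rfl, rfl⟩
      simp at h
    rw [trimTree, if_neg hn, ihl (by omega), ihr]
    rw [BinaryTree.numLeaves_eq_numNodes_succ]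
    omega

theorem eq_nil_of_numNodes {T : PlaneTree} (h : T.numNodes = 0) : T = BinaryTree.nil := by
  cases T with
  | nil => rfl
  | node _ l r => simp [BinaryTree.numNodes] at h

/-- Trimming is inverted by splitting the leaf `i`. The deleted node lies in one of the two
subtrees; the other is not trimmed, and is only shifted by one if it lies to the right. -/
theorem trimTree_spec {i s : ℕ} {T : PlaneTree} (h : (i, i, i) ∈ treeSpans s T) :
    T.numNodes = (trimTree i s T).numNodes + 1 ∧
      treeSpans s T = insert (i, i, i) (splitSpan i '' treeSpans s (trimTree i s T)) := by
  induction T generalizing s with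
  | nil => simp [treeSpans] at h
  | node _ l r ihl ihr =>
    by_cases hn : l = BinaryTree.nil ∧ r = BinaryTree.nil ∧ s = i
    · obtain ⟨rfl, rfl, rfl⟩ := hn
      simp [trimTree, treeSpans, BinaryTree.numNodes]
    rw [trimTree, if_neg hn]
    simp only [treeSpans, Set.mem_insert_iff, Set.mem_union, Prod.mk.injEq] at h
    simp only [BinaryTree.numNodes, treeSpans, BinaryTree.numLeaves_eq_numNodes_succ, ← add_assoc,
      Set.image_insert_eq, Set.image_union]
    rcases h with h | h | h
    · exact absurd ⟨eq_nil_of_numNodes (by omega), eq_nil_of_numNodes (by omega), by omega⟩ hn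
    · have hb := treeSpans_bounds h
      obtain ⟨h1, h2⟩ := ihl h
      rw [trimTree_eq_self (T := r) (by omega), splitSpan_image_of_lt r (by omega), h2]
      refine ⟨by omega, ?_⟩
      have : splitSpan i (s, s + (trimTree i s l).numNodes,
          s + (trimTree i s l).numNodes + r.numNodes) =
          (s, s + l.numNodes, s + l.numNodes + r.numNodes) := by
        simp only [splitSpan, Prod.mk.injEq]
        refine ⟨if_pos ?_, ?_, ?_⟩
        · omega
        · rw [if_neg] <;> omega
        · rw [if_neg] <;> omega
      rw [this, h1, Set.insert_union, Set.insert_comm]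
      rfl
    · have hb := treeSpans_bounds h
      obtain ⟨h1, h2⟩ := ihr h
      rw [trimTree_eq_self (T := l) (by omega), splitSpan_image_of_gt l (by omega), h2]
      refine ⟨by omega, ?_⟩
      have : splitSpan i (s, s + l.numNodes,
          s + l.numNodes + (trimTree i (s + l.numNodes + 1) r).numNodes) =
          (s, s + l.numNodes, s + l.numNodes + r.numNodes) := by
        simp only [splitSpan, Prod.mk.injEq]
        refine ⟨if_pos ?_, if_pos ?_, ?_⟩
        · omega
        · omega
        · rw [if_neg] <;> omega
      rw [this, Set.union_insert, Set.insert_comm]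

/-! ### Spans, quasi-descents and support of a forest -/

namespace IndexedForest

/-- The spans of the internal nodes of `F`. -/
def spans (F : IndexedForest) : Set (ℕ × ℕ × ℕ) :=
  ⋃ k, treeSpans (F.start k) (F.tree k)

theorem mem_spans_iff (F : IndexedForest) (p : ℕ × ℕ × ℕ) :
    p ∈ F.spans ↔ ∃ v ∈ F.internal, (v.flag, v.label, v.last) = p := by
  simp only [spans, Set.mem_iUnion, mem_treeSpans_iff, internal, Set.mem_ofPred_eq]
  grind

theorem mem_qdes_iff (F : IndexedForest) (i : ℕ) : i ∈ F.qdes ↔ (i, i, i) ∈ F.spans := by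
  rw [mem_spans_iff]
  constructor
  · rintro ⟨v, hv, ⟨h1, h2⟩, rfl⟩
    exact ⟨v, hv, by simp [Vertex.label, Vertex.last, h1, h2]⟩
  · rintro ⟨v, hv, h⟩
    simp only [Vertex.label, Vertex.last, Prod.mk.injEq] at h
    exact ⟨v, hv, ⟨eq_nil_of_numNodes (by omega), eq_nil_of_numNodes (by omega)⟩, h.1⟩

theorem start_succ (F : IndexedForest) (k : ℕ) :
    F.start (k + 1) = F.start k + (F.tree k).numNodes + 1 := by
  rw [start, Finset.sum_range_succ, BinaryTree.numLeaves_eq_numNodes_succ]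
  rfl

theorem start_add_le (F : IndexedForest) {j k : ℕ} (h : j < k) :
    F.start j + (F.tree j).numNodes + 1 ≤ F.start k := by
  induction k, h using Nat.le_induction with
  | base => exact (F.start_succ j).ge
  | succ k _ ih => rw [start_succ]; omega

/-- Only the tree containing the terminal node changes; the later trees start one leaf earlier in
the trimmed forest. -/
theorem spans_eq_of_mem_qdes {F : IndexedForest} {i : ℕ} (h : i ∈ F.qdes) :
    F.spans = insert (i, i, i) (splitSpan i '' (F.trim i).spans) := by
  rw [mem_qdes_iff, spans, Set.mem_iUnion] at h
  obtain ⟨m, hm⟩ := h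
  have hb := treeSpans_bounds hm
  obtain ⟨h1, h2⟩ := trimTree_spec hm
  have tree_lt : ∀ k < m, (F.trim i).tree k = F.tree k := fun k hk =>
    trimTree_eq_self (by have := F.start_add_le hk; omega)
  have tree_gt : ∀ k, m < k → (F.trim i).tree k = F.tree k := fun k hk =>
    trimTree_eq_self (by have := F.start_add_le hk; omega)
  have start_le : ∀ k ≤ m, (F.trim i).start k = F.start k := fun k hk =>
    Finset.sum_congr rfl fun j hj => by rw [tree_lt j (by simp at hj; omega)]
  have start_gt : ∀ k, m < k → (F.trim i).start k + 1 = F.start k := by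
    intro k hk
    induction k, hk using Nat.le_induction with
    | base =>
      rw [start_succ, start_succ, start_le m le_rfl, h1]
      change F.start m + (trimTree i (F.start m) (F.tree m)).numNodes + 1 + 1 = _
      omega
    | succ k hk ih => rw [start_succ, start_succ, tree_gt k hk]; omega
  have key : ∀ k, k ≠ m → splitSpan i '' treeSpans ((F.trim i).start k) ((F.trim i).tree k) =
      treeSpans (F.start k) (F.tree k) := by
    intro k hk
    rcases lt_or_gt_of_ne hk with hk | hk
    · have := F.start_add_le hk
      rw [start_le k hk.le, tree_lt k hk, splitSpan_image_of_gt _ (by omega)]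
    · have := F.start_add_le hk
      have := start_gt k hk
      rw [tree_gt k hk, splitSpan_image_of_lt _ (by omega), this]
  have keym : insert (i, i, i) (splitSpan i '' treeSpans ((F.trim i).start m) ((F.trim i).tree m)) =
      treeSpans (F.start m) (F.tree m) := by
    rw [start_le m le_rfl, h2]
    rfl
  ext p
  simp only [spans, Set.image_iUnion, Set.mem_insert_iff, Set.mem_iUnion]
  constructor
  · rintro ⟨k, hk⟩
    by_cases e : k = m
    · subst e
      rw [← keym] at hk
      exact hk.imp_right fun h => ⟨k, h⟩
    · exact Or.inr ⟨k, by rwa [key k e]⟩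
  · rintro (rfl | ⟨k, hk⟩)
    · exact ⟨m, hm⟩
    · refine ⟨k, ?_⟩
      by_cases e : k = m
      · subst e
        rw [← keym]
        exact Or.inr hk
      · rwa [← key k e]

theorem spans_bounds {F : IndexedForest} {a b c : ℕ} (h : (a, b, c) ∈ F.spans) :
    a ≤ b ∧ b ≤ c := by
  obtain ⟨k, hk⟩ := Set.mem_iUnion.1 h
  exact ⟨(treeSpans_bounds hk).2.1, (treeSpans_bounds hk).2.2.1⟩

theorem spans_label_mem {F : IndexedForest} {a b c d : ℕ} (h : (a, b, c) ∈ F.spans)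
    (h₁ : a ≤ d) (h₂ : d ≤ c) : ∃ p ∈ F.spans, p.2.1 = d := by
  obtain ⟨k, hk⟩ := Set.mem_iUnion.1 h
  obtain ⟨p, hp, e⟩ := treeSpans_label_mem hk h₁ h₂
  exact ⟨p, Set.mem_iUnion.2 ⟨k, hp⟩, e⟩

theorem root_mem_treeSpans {s : ℕ} {T : PlaneTree} (h : T ≠ BinaryTree.nil) :
    ∃ a, (s, a, s + T.numNodes - 1) ∈ treeSpans s T := by
  cases T with
  | nil => exact absurd rfl h
  | node _ l r =>
    refine ⟨s + l.numNodes, ?_⟩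
    simp only [BinaryTree.numNodes, treeSpans]
    exact Or.inl (by simp only [Prod.mk.injEq, true_and]; omega)

theorem numNodes_pos {T : PlaneTree} (h : T ≠ BinaryTree.nil) : 0 < T.numNodes :=
  Nat.pos_of_ne_zero fun h' => h (eq_nil_of_numNodes h')

/-- The rightmost leaf of a nontrivial tree is one more than the last label of its root. -/
theorem support_subset_iff (F : IndexedForest) (n : ℕ) :
    F.support ⊆ Set.Iio (n + 1) ↔ ∀ p ∈ F.spans, p.2.2 < n := by
  constructor
  · rintro h ⟨a, b, c⟩ hp
    obtain ⟨k, hk⟩ := Set.mem_iUnion.1 hp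
    have hb := treeSpans_bounds hk
    have hne : F.tree k ≠ BinaryTree.nil := by
      intro e
      simp [e, treeSpans] at hk
    have : c + 1 ∈ F.support :=
      ⟨k, hne, by omega, by rw [BinaryTree.numLeaves_eq_numNodes_succ]; omega⟩
    have := h this
    simp at this
    exact this
  · rintro h m ⟨k, hne, h1, h2⟩
    obtain ⟨a, ha⟩ := root_mem_treeSpans (s := F.start k) hne
    have := h _ (Set.mem_iUnion.2 ⟨k, ha⟩)
    have := numNodes_pos hne
    rw [BinaryTree.numLeaves_eq_numNodes_succ] at h2
    simp only [Set.mem_Iio] at *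
    omega

theorem lt_of_mem_qdes {F : IndexedForest} {n i : ℕ} (h : F.support ⊆ Set.Iio (n + 1))
    (hi : i ∈ F.qdes) : i < n :=
  (F.support_subset_iff n).1 h _ ((F.mem_qdes_iff i).1 hi)

theorem support_trim_subset {F : IndexedForest} {n i : ℕ}
    (h : F.support ⊆ Set.Iio (n + 1 + 1)) (hi : i ∈ F.qdes) :
    (F.trim i).support ⊆ Set.Iio (n + 1) := by
  have hin := lt_of_mem_qdes h hi
  rw [support_subset_iff] at h ⊢
  rintro ⟨a, b, c⟩ hp
  have := h (splitSpan i (a, b, c)) (by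
    rw [spans_eq_of_mem_qdes hi]
    exact Or.inr ⟨_, hp, rfl⟩)
  simp only [splitSpan] at this ⊢
  split_ifs at this <;> omega

theorem exists_support_subset (F : IndexedForest) : ∃ n, F.support ⊆ Set.Iio (n + 1) := by
  obtain ⟨B, hB⟩ := (F.finite_nontrivial.image fun k => F.start k + (F.tree k).numNodes).bddAbove
  refine ⟨B, ?_⟩
  rintro m ⟨k, hne, -, h2⟩
  have := hB ⟨k, hne, rfl⟩
  rw [BinaryTree.numLeaves_eq_numNodes_succ] at h2
  simp only [Set.mem_Iio] at *
  omega

theorem spans_eq_empty_iff (F : IndexedForest) : F.spans = ∅ ↔ F = empty := by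
  constructor
  · intro h
    ext k : 2
    by_contra hne
    obtain ⟨a, ha⟩ := root_mem_treeSpans (s := F.start k) hne
    have : (F.start k, a, F.start k + (F.tree k).numNodes - 1) ∈ F.spans :=
      Set.mem_iUnion.2 ⟨k, ha⟩
    rw [h] at this
    exact this
  · rintro rfl
    simp [spans, empty, treeSpans]

/-! ### Sylvester words -/

/-- The condition on children propagates down the tree: the root precedes the root of each subtree,
which by induction precedes everything below it. -/
theorem idxOf_label_le_of_children {s : ℕ} {T : PlaneTree} {w : List ℕ}
    (h : ∀ u ∈ internalNodes s T, ∀ v ∈ internalNodes s T, u.IsChildOf v →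
      w.idxOf v.label < w.idxOf u.label) :
    ∀ p ∈ treeSpans s T, ∀ b, p.1 ≤ b → b ≤ p.2.2 → w.idxOf p.2.1 ≤ w.idxOf b := by
  induction T generalizing s with
  | nil => simp [treeSpans]
  | node _ l r ihl ihr =>
    have hl := ihl (s := s) fun u hu v hv => h u (by simp [internalNodes, hu]) v
      (by simp [internalNodes, hv])
    have hr := ihr (s := s + l.numLeaves) fun u hu v hv => h u (by simp [internalNodes, hu]) v
      (by simp [internalNodes, hv])
    rw [BinaryTree.numLeaves_eq_numNodes_succ, ← add_assoc] at hr
    have hroot : (⟨s, l, r⟩ : Vertex) ∈ internalNodes s (BinaryTree.node () l r) := by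
      simp [internalNodes]
    rintro p (rfl | hp | hp) b h1 h2
    · simp only at h1 h2 ⊢
      rcases lt_trichotomy b (s + l.numNodes) with hb | rfl | hb
      · cases l with
        | nil => simp [BinaryTree.numNodes] at hb; omega
        | node _ l₁ l₂ =>
          have h3 := hl _ (Or.inl rfl) b h1 (by simp [BinaryTree.numNodes] at hb ⊢; omega)
          have h4 := h ⟨s, l₁, l₂⟩ (by simp [internalNodes]) _ hroot (Or.inl ⟨rfl, rfl⟩)
          exact (h4.trans_le h3).le
      · exact le_rfl
      · cases r with
        | nil => simp [BinaryTree.numNodes] at h2; omega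
        | node _ r₁ r₂ =>
          have h3 := hr _ (Or.inl rfl) b hb (by simp [BinaryTree.numNodes] at h2 ⊢; omega)
          have h4 := h ⟨s + l.numLeaves, r₁, r₂⟩ (by simp [internalNodes]) _ hroot
            (Or.inr ⟨rfl, rfl⟩)
          simp only [Vertex.label, BinaryTree.numLeaves_eq_numNodes_succ, ← add_assoc] at h4
          exact (h4.trans_le h3).le
    · exact hl p hp b h1 h2
    · exact hr p hp b h1 h2

theorem exists_internal_label_iff (F : IndexedForest) (a : ℕ) :
    (∃ v ∈ F.internal, v.label = a) ↔ ∃ p ∈ F.spans, p.2.1 = a := by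
  simp only [mem_spans_iff]
  grind

/-- A word is a Sylvester word exactly if it lists the labels once each and the label of a node
precedes all the labels in its subtree. -/
theorem mem_sylvester_iff (F : IndexedForest) (w : List ℕ) :
    w ∈ F.sylvester ↔ w.Nodup ∧ (∀ a, a ∈ w ↔ ∃ p ∈ F.spans, p.2.1 = a) ∧
      ∀ p ∈ F.spans, ∀ b, p.1 ≤ b → b ≤ p.2.2 → w.idxOf p.2.1 ≤ w.idxOf b := by
  simp only [sylvester, Set.mem_ofPred_eq, exists_internal_label_iff]
  refine and_congr_right fun _ => and_congr_right fun hw => ⟨fun h p hp => ?_, ?_⟩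
  · obtain ⟨k, hk⟩ := Set.mem_iUnion.1 hp
    exact idxOf_label_le_of_children (fun u hu v hv => h u ⟨k, hu⟩ v ⟨k, hv⟩) p hk
  · intro h u hu v hv huv
    have hle := h _ ((F.mem_spans_iff _).2 ⟨v, hv, rfl⟩) u.label
    have hmem : v.label ∈ w := (hw _).2 ⟨_, (F.mem_spans_iff _).2 ⟨v, hv, rfl⟩, rfl⟩
    have hb : v.flag ≤ u.label ∧ u.label ≤ v.last ∧ u.label ≠ v.label := by
      rcases huv with ⟨h1, h2⟩ | ⟨h1, h2⟩ <;>
        simp only [Vertex.label, Vertex.last, ← h2, h1, Vertex.subtree, BinaryTree.numNodes,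
          BinaryTree.numLeaves_eq_numNodes_succ] <;> omega
    refine lt_of_le_of_ne (hle hb.1 hb.2.1) fun e => hb.2.2 ?_
    exact ((List.idxOf_inj hmem).1 e).symm

/-- The increasing map whose image omits `i`. -/
def skipAt (i a : ℕ) : ℕ := if a < i then a else a + 1

/-! ### Inserting and deleting a letter in a Sylvester word -/

theorem skipAt_injective (i : ℕ) : Function.Injective (skipAt i) := by
  intro a b h
  simp only [skipAt] at h
  split_ifs at h <;> omega

theorem skipAt_ne (i a : ℕ) : skipAt i a ≠ i := by
  simp only [skipAt]
  split_ifs <;> omega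

theorem exists_skipAt_eq {i b : ℕ} (h : b ≠ i) : ∃ a, skipAt i a = b := by
  rcases lt_or_gt_of_ne h with h | h
  · exact ⟨b, if_pos h⟩
  · exact ⟨b - 1, by rw [skipAt, if_neg] <;> omega⟩

theorem idxOf_insert_le_iff {u v : List ℕ} {i c d : ℕ} (hc : c ≠ i) (hd : d ≠ i) :
    (u ++ i :: v).idxOf c ≤ (u ++ i :: v).idxOf d ↔ (u ++ v).idxOf c ≤ (u ++ v).idxOf d := by
  have hcu := List.idxOf_lt_length_iff (a := c) (l := u)
  have hdu := List.idxOf_lt_length_iff (a := d) (l := u)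
  by_cases h1 : c ∈ u <;> by_cases h2 : d ∈ u <;>
    simp only [List.idxOf_append, h1, h2, if_true, if_false, List.idxOf_cons_ne _ hc.symm,
      List.idxOf_cons_ne _ hd.symm, iff_true, iff_false] at hcu hdu ⊢ <;> omega

theorem idxOf_map_skipAt (i : ℕ) (w : List ℕ) (c : ℕ) :
    (w.map (skipAt i)).idxOf (skipAt i c) = w.idxOf c := by
  induction w with
  | nil => rfl
  | cons a w ih =>
    by_cases h : a = c
    · subst h; simp
    · rw [List.map_cons, List.idxOf_cons_ne _ h,
        List.idxOf_cons_ne _ ((skipAt_injective i).ne h), ih]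

/-- If the subtree of the node labelled `i` had another node, its interval of labels would contain
`i - 1` or `i + 1`. That label would have to follow `i`, but `v` has no letter below `i + 2`. -/
theorem mem_qdes_of_insert_mem_sylvester {F : IndexedForest} {i : ℕ} {u v : List ℕ}
    (hv : ∀ b ∈ v, i + 2 ≤ b) (h : u ++ i :: v ∈ F.sylvester) : i ∈ F.qdes := by
  obtain ⟨hnd, hmem, hord⟩ := (F.mem_sylvester_iff _).1 h
  obtain ⟨⟨a, b, c⟩, hp, rfl⟩ := (hmem i).1 (by simp)
  obtain ⟨hab, hbc⟩ := spans_bounds hp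
  have hiu : b ∉ u := fun hb => (List.disjoint_of_nodup_append hnd) hb (by simp)
  have key : ∀ d, a ≤ d → d ≤ c → d < b + 2 → d = b := by
    intro d h1 h2 h3
    by_contra hne
    have hd : d ∈ u ++ b :: v := (hmem d).2 (spans_label_mem hp h1 h2)
    have hdv : d ∉ v := fun hd => absurd (hv d hd) (by simp only; omega)
    have hdu : d ∈ u := by simpa [hne, hdv] using hd
    have := hord _ hp d h1 h2
    simp only [List.idxOf_append, hiu, hdu, if_true, if_false, List.idxOf_cons_self] at this
    have := List.idxOf_lt_length_iff.2 hdu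
    omega
  have ha : a = b := by
    by_contra hne
    have := key (b - 1) (by omega) (by omega) (by omega)
    omega
  have hc : c = b := by
    by_contra hne
    have := key (b + 1) (by omega) (by omega) (by omega)
    omega
  subst ha hc
  exact (F.mem_qdes_iff _).2 hp

/-- Relative positions of the letters other than `i` do not change, so the only new condition is
that each ancestor of the terminal node precedes `i`. The bound on `v` guarantees this. -/
theorem insert_mem_sylvester_iff {F : IndexedForest} {i : ℕ} (hi : i ∈ F.qdes) {u v w : List ℕ}
    (hv : ∀ b ∈ v, i + 2 ≤ b) (hw : u ++ v = w.map (skipAt i)) :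
    u ++ i :: v ∈ F.sylvester ↔ w ∈ (F.trim i).sylvester := by
  rw [mem_sylvester_iff, mem_sylvester_iff, spans_eq_of_mem_qdes hi]
  have hin : i ∉ u ++ v := by
    rw [hw, List.mem_map]
    rintro ⟨a, -, h⟩
    exact skipAt_ne i a h
  have hnd : (u ++ i :: v).Nodup ↔ w.Nodup := by
    rw [List.nodup_middle, List.nodup_cons, hw, List.nodup_map_iff (skipAt_injective i), ← hw]
    exact and_iff_right hin
  have hmem : ∀ a, skipAt i a ∈ u ++ i :: v ↔ a ∈ w := by
    intro a
    rw [← List.mem_map_of_injective (skipAt_injective i) (l := w), ← hw]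
    simp [skipAt_ne]
  refine and_congr hnd ?_
  have hlab : (∀ a, a ∈ u ++ i :: v ↔
      ∃ p ∈ insert (i, i, i) (splitSpan i '' (F.trim i).spans), p.2.1 = a) ↔
      ∀ a, a ∈ w ↔ ∃ p ∈ (F.trim i).spans, p.2.1 = a := by
    have e : ∀ a, (∃ p ∈ insert (i, i, i) (splitSpan i '' (F.trim i).spans), p.2.1 = a) ↔
        a = i ∨ ∃ p ∈ (F.trim i).spans, skipAt i p.2.1 = a := by
      intro a
      simp only [Set.mem_insert_iff, Set.mem_image, or_and_right, exists_or, exists_eq_left,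
        exists_exists_and_eq_and]
      exact or_congr eq_comm Iff.rfl
    simp only [e]
    constructor
    · intro h a
      rw [← hmem, h]
      simp [skipAt_ne, (skipAt_injective i).eq_iff]
    · intro h a
      by_cases ha : a = i
      · simp [ha]
      · obtain ⟨a, rfl⟩ := exists_skipAt_eq ha
        rw [hmem, h]
        simp [skipAt_ne, (skipAt_injective i).eq_iff]
  rw [hlab]
  refine and_congr_right fun hlab' => ?_
  have hidx : ∀ c d, (u ++ i :: v).idxOf (skipAt i c) ≤ (u ++ i :: v).idxOf (skipAt i d) ↔
      w.idxOf c ≤ w.idxOf d := by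
    intro c d
    rw [idxOf_insert_le_iff (skipAt_ne i c) (skipAt_ne i d), hw, idxOf_map_skipAt, idxOf_map_skipAt]
  constructor
  · rintro h ⟨a, b, c⟩ hp d h1 h2
    simp only at h1 h2
    have := h _ (Or.inr ⟨_, hp, rfl⟩) (skipAt i d)
      (by simp only [splitSpan, skipAt]; split_ifs <;> omega)
      (by simp only [splitSpan, skipAt]; split_ifs <;> omega)
    exact (hidx _ _).1 this
  · rintro h p (rfl | ⟨⟨a, b, c⟩, hp, rfl⟩) d h1 h2
    · rw [le_antisymm h2 h1]
    · change (u ++ i :: v).idxOf (skipAt i b) ≤ _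
      obtain ⟨hab, hbc⟩ := spans_bounds hp
      by_cases hd : d = i
      · subst hd
        -- An ancestor of the new node has `d + 1` or `d - 1` in its interval. Such a label is too
        -- small for `v`, so it lies in `u`, before `d`, and the ancestor comes no later than it.
        obtain ⟨e, he1, he2, he3⟩ : ∃ e, a ≤ e ∧ e ≤ c ∧ skipAt d e < d + 2 := by
          simp only [splitSpan, skipAt] at h1 h2 ⊢
          by_cases hc : d ≤ c
          · refine ⟨d, ?_, hc, ?_⟩
            · split_ifs at h1 <;> omega
            · split_ifs <;> omega
          · refine ⟨c, by omega, le_rfl, ?_⟩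
            split_ifs <;> omega
        have hew : skipAt d e ∈ u ++ d :: v :=
          (hmem e).2 ((hlab' e).2 (spans_label_mem hp he1 he2))
        have hev : skipAt d e ∉ v := fun h' => absurd (hv _ h') (by omega)
        have heu : skipAt d e ∈ u := by simpa [skipAt_ne, hev] using hew
        have hdu : d ∉ u := fun h' => hin (by simp [h'])
        refine ((hidx b e).2 (h _ hp e he1 he2)).trans ?_
        simp only [List.idxOf_append, heu, hdu, if_true, if_false, List.idxOf_cons_self]
        have := List.idxOf_lt_length_iff.2 heu
        omega
      · obtain ⟨d, rfl⟩ := exists_skipAt_eq hd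
        rw [hidx]
        refine h _ hp d ?_ ?_
        · simp only [splitSpan, skipAt] at h1 h2 ⊢
          split_ifs at h1 h2 <;> omega
        · simp only [splitSpan, skipAt] at h1 h2 ⊢
          split_ifs at h1 h2 <;> omega

theorem nil_mem_sylvester_iff (F : IndexedForest) : [] ∈ F.sylvester ↔ F = empty := by
  rw [← spans_eq_empty_iff, mem_sylvester_iff, Set.eq_empty_iff_forall_notMem]
  simp only [List.nodup_nil, List.not_mem_nil, false_iff, List.idxOf_nil, le_refl, true_and,
    implies_true, and_true, not_exists, not_and]
  exact ⟨fun h p hp => h _ p hp rfl, fun h _ p hp => absurd hp (h p)⟩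

theorem length_eq_of_mem_sylvester {F : IndexedForest} {w w' : List ℕ} (h : w ∈ F.sylvester)
    (h' : w' ∈ F.sylvester) : w.length = w'.length :=
  ((List.perm_ext_iff_of_nodup h.1 h'.1).2 fun a => (h.2.1 a).trans (h'.2.1 a).symm).length_eq

end IndexedForest

open MvPolynomial IndexedForest

/-! ### Polynomials annihilated by the trimming operations -/

theorem x_sub_t_ne_zero (i : ℕ) : x i - t i ≠ 0 := by
  rw [sub_ne_zero, x, t]
  intro h
  exact Sum.inl_ne_inr (X_injective h)

theorem subst_x (a b : ℕ → Pol) (i : ℕ) : subst a b (x i) = a i := by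
  simp [subst, x]

theorem subst_t (a b : ℕ → Pol) (i : ℕ) : subst a b (t i) = b i := by
  simp [subst, t]

theorem algHom_ext_xt {φ ψ : Pol →ₐ[ℤ] Pol} (hx : ∀ i, φ (x i) = ψ (x i))
    (ht : ∀ i, φ (t i) = ψ (t i)) : φ = ψ := by
  apply MvPolynomial.algHom_ext
  rintro (i | i)
  · exact hx i
  · exact ht i

/-- The substitution `x_j = t_j` for `j ≥ k`. -/
noncomputable def specializeFrom (k : ℕ) : Pol →ₐ[ℤ] Pol :=
  subst (fun j => if j < k then x j else t j) t

theorem specializeFrom_eq_self_of_le {k l : ℕ} {f : Pol} (hkl : k ≤ l) (h : specializeFrom k f = f) :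
    specializeFrom l f = f := by
  have : (specializeFrom l).comp (specializeFrom k) = specializeFrom k := by
    apply algHom_ext_xt <;> intro i
    · simp only [AlgHom.comp_apply, specializeFrom, subst_x]
      split_ifs with h
      · rw [subst_x, if_pos (by omega)]
      · rw [subst_t]
    · simp only [AlgHom.comp_apply, specializeFrom, subst_t]
  rw [← h, ← AlgHom.comp_apply, this]

theorem exists_specializeFrom_eq_self (f : Pol) : ∃ k, specializeFrom k f = f := by
  induction f using MvPolynomial.induction_on with
  | C a => exact ⟨0, by simp [specializeFrom, subst]⟩
  | add p q hp hq =>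
    obtain ⟨k, hk⟩ := hp
    obtain ⟨l, hl⟩ := hq
    exact ⟨max k l, by rw [map_add, specializeFrom_eq_self_of_le (le_max_left k l) hk,
      specializeFrom_eq_self_of_le (le_max_right k l) hl]⟩
  | mul_X p s hp =>
    obtain ⟨k, hk⟩ := hp
    rcases s with i | i
    · refine ⟨max k (i + 1), ?_⟩
      have : specializeFrom (max k (i + 1)) (x i) = x i := by
        rw [specializeFrom, subst_x, if_pos (by omega)]
      rw [map_mul, specializeFrom_eq_self_of_le (le_max_left k _) hk]
      exact congrArg _ this
    · refine ⟨k, ?_⟩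
      rw [map_mul, hk]
      exact congrArg _ (subst_t _ _ i)

theorem eq_zero_of_eope_eq_zero {f : Pol} (h : ∀ i, eope i f = 0) (h0 : subst t t f = 0) :
    f = 0 := by
  obtain ⟨k, hk⟩ := exists_specializeFrom_eq_self f
  have key : ∀ k, specializeFrom k f = f → specializeFrom 0 f = f := by
    intro k
    induction k with
    | zero => exact id
    | succ k ih =>
      intro hk
      apply ih
      have hrope : ropePlus k f = ropeMinus k f := by
        have := mul_eope k f
        rw [h k, mul_zero] at this
        exact (sub_eq_zero.1 this.symm)
      -- `f` involves only `x_0, …, x_k`, which `ropePlus k` fixes; on them `ropeMinus k` merely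
      -- replaces `x_k` by `t_k`.
      have hplus : (ropePlus k).comp (specializeFrom (k + 1)) = specializeFrom (k + 1) := by
        apply algHom_ext_xt <;> intro i
        · simp only [AlgHom.comp_apply, specializeFrom, ropePlus, subst_x]
          split_ifs with h
          · rw [subst_x, if_pos (by omega)]
          · rw [subst_t]
        · simp only [AlgHom.comp_apply, specializeFrom, ropePlus, subst_t]
      have hminus : (ropeMinus k).comp (specializeFrom (k + 1)) = specializeFrom k := by
        apply algHom_ext_xt <;> intro i
        · simp only [AlgHom.comp_apply, specializeFrom, ropeMinus, subst_x]
          split_ifs with h1 h2 h2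
          · rw [subst_x, if_pos h2]
          · obtain rfl : i = k := by omega
            rw [subst_x, if_neg h2, if_pos rfl]
          · omega
          · rw [subst_t]
        · simp only [AlgHom.comp_apply, specializeFrom, ropeMinus, subst_t]
      rw [← hminus, AlgHom.comp_apply, hk, ← hrope, ← hk, ← AlgHom.comp_apply, hplus, hk]
  rw [← key k hk]
  simpa [specializeFrom] using h0

/-! ### Subword sums -/

open Classical in
/-- The subword generating function of a list of pairs (value, weight). -/
noncomputable def wordSum : List (ℕ × Pol) → Set (List ℕ) → Pol
  | [], D => if [] ∈ D then 1 else 0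
  | p :: L, D => wordSum L D + p.2 * wordSum L {w | p.1 :: w ∈ D}

-- Recursion on the first letter is available for `sublists'`, which lists the same subwords in
-- another order.
open Classical in
theorem subwordSum_eq_wordSum {α : Type} (value : α → ℕ) (weight : α → Pol) (ω : List α)
    (D : Set (List ℕ)) :
    subwordSum value weight ω D = wordSum (ω.map fun a => (value a, weight a)) D := by
  have h : subwordSum value weight ω D = ((ω.sublists'.filter fun π => π.map value ∈ D).map
      fun π => (π.map weight).prod).sum :=
    (((List.sublists_perm_sublists' ω).filter _).map _).sum_eq
  rw [h]
  clear h
  induction ω generalizing D with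
  | nil =>
    by_cases h : [] ∈ D <;> simp [wordSum, h]
  | cons a ω ih =>
    rw [List.sublists'_cons, List.filter_append, List.map_append, List.sum_append, ih,
      List.map_cons, wordSum, ← ih {w | value a :: w ∈ D}, List.filter_map, List.map_map,
      ← List.sum_map_mul_left]
    simp [Function.comp_def]

open Classical in
theorem wordSum_congr {L : List (ℕ × Pol)} {D D' : Set (List ℕ)}
    (h : ∀ w, (∀ a ∈ w, a ∈ L.map Prod.fst) → (w ∈ D ↔ w ∈ D')) : wordSum L D = wordSum L D' := by
  induction L generalizing D D' with
  | nil =>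
    rw [wordSum, wordSum]
    exact if_congr (h [] (by simp)) rfl rfl
  | cons p L ih =>
    rw [wordSum, wordSum, ih fun w hw => h w fun a ha => List.mem_cons_of_mem _ (hw a ha),
      ih (D := {w | p.1 :: w ∈ D}) (D' := {w | p.1 :: w ∈ D'})]
    intro w hw
    refine h _ fun a ha => ?_
    rcases List.mem_cons.1 ha with rfl | ha
    · simp
    · exact List.mem_cons_of_mem _ (hw a ha)

theorem wordSum_empty (L : List (ℕ × Pol)) : wordSum L ∅ = 0 := by
  induction L with
  | nil => simp [wordSum]
  | cons p L ih =>
    rw [wordSum, ih]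
    simpa using Or.inr ih

theorem wordSum_map (φ : Pol →ₐ[ℤ] Pol) (g : ℕ → ℕ) (L : List (ℕ × Pol)) (D : Set (List ℕ)) :
    wordSum (L.map (Prod.map g φ)) D = φ (wordSum L (List.map g ⁻¹' D)) := by
  induction L generalizing D with
  | nil => by_cases h : [] ∈ D <;> simp [wordSum, h]
  | cons p L ih =>
    rw [List.map_cons, wordSum, wordSum, ih, ih, map_add, map_mul]
    rfl

theorem wordSum_filter_ne {i : ℕ} (L : List (ℕ × Pol)) {D : Set (List ℕ)} (h : ∀ w ∈ D, i ∉ w) :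
    wordSum (L.filter fun p => p.1 ≠ i) D = wordSum L D := by
  induction L generalizing D with
  | nil => rfl
  | cons p L ih =>
    by_cases hp : p.1 = i
    · have : {w | p.1 :: w ∈ D} = (∅ : Set (List ℕ)) := by
        ext w
        simp only [Set.mem_ofPred_eq, Set.mem_empty_iff_false, iff_false]
        exact fun hw => h _ hw (by simp [hp])
      rw [List.filter_cons_of_neg (by simp [hp]), wordSum, this, wordSum_empty, mul_zero, add_zero,
        ih h]
    · rw [List.filter_cons_of_pos (by simp [hp]), wordSum, wordSum, ih h, ih]
      intro w hw hi
      exact h _ hw (List.mem_cons_of_mem _ hi)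

/-- The sum splits according to whether the subword uses `p`; the part `v` chosen after `p` has its
letters in `L₂`, so `D'` need only be right for such `v`. -/
theorem wordSum_insert {L₁ L₂ : List (ℕ × Pol)} {p : ℕ × Pol} {D D' : Set (List ℕ)}
    (h : ∀ u v, (∀ b ∈ v, b ∈ L₂.map Prod.fst) → (u ++ p.1 :: v ∈ D ↔ u ++ v ∈ D')) :
    wordSum (L₁ ++ p :: L₂) D = wordSum (L₁ ++ L₂) D + p.2 * wordSum (L₁ ++ L₂) D' := by
  induction L₁ generalizing D D' with
  | nil =>
    rw [List.nil_append, List.nil_append, wordSum]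
    congr 2
    exact wordSum_congr fun w hw => h [] w hw
  | cons q L₁ ih =>
    simp only [List.cons_append, wordSum]
    rw [ih h, ih (D := {w | q.1 :: w ∈ D}) (D' := {w | q.1 :: w ∈ D'})
      fun u v hv => h (q.1 :: u) v hv]
    ring

theorem wordSum_zero_weight (L₁ L₂ : List (ℕ × Pol)) (a : ℕ) (D : Set (List ℕ)) :
    wordSum (L₁ ++ (a, 0) :: L₂) D = wordSum (L₁ ++ L₂) D := by
  induction L₁ generalizing D with
  | nil => simp [wordSum]
  | cons q L₁ ih => simp only [List.cons_append, wordSum, ih]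

/-- Subwords using exactly one of the two letters cancel in pairs, and those using both would repeat
`a`. -/
theorem wordSum_cancel_pair (L₁ L₂ : List (ℕ × Pol)) (a : ℕ) (p : Pol) {D : Set (List ℕ)}
    (h : ∀ w ∈ D, w.Nodup) :
    wordSum (L₁ ++ (a, p) :: (a, -p) :: L₂) D = wordSum (L₁ ++ L₂) D := by
  induction L₁ generalizing D with
  | nil =>
    have : {w | a :: w ∈ {w | a :: w ∈ D}} = (∅ : Set (List ℕ)) := by
      ext w
      simp only [Set.mem_ofPred_eq, Set.mem_empty_iff_false, iff_false]
      intro hw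
      simpa using h _ hw
    simp only [List.nil_append, wordSum, this, wordSum_empty]
    ring
  | cons q L₁ ih =>
    simp only [List.cons_append, wordSum]
    rw [ih h, ih]
    intro w hw
    exact (h _ hw).of_cons

/-- The pairs are nested, with the head of `l` innermost, so they cancel from the inside outwards.
-/
theorem wordSum_cancel (L₁ L₂ l : List (ℕ × Pol)) {D : Set (List ℕ)} (h : ∀ w ∈ D, w.Nodup) :
    wordSum (L₁ ++ (l.reverse ++ (l.map (fun p => (p.1, -p.2)) ++ L₂))) D =
      wordSum (L₁ ++ L₂) D := by
  induction l generalizing L₁ L₂ with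
  | nil => rfl
  | cons p l ih =>
    rw [← ih L₁ L₂]
    simpa using wordSum_cancel_pair (L₁ ++ l.reverse) (l.map (fun p => (p.1, -p.2)) ++ L₂)
      p.1 p.2 h

theorem wordSum_isHomogeneous {L : List (ℕ × Pol)} {D : Set (List ℕ)} {d : ℕ}
    (hL : ∀ p ∈ L, p.2.IsHomogeneous 1) (hD : ∀ w ∈ D, w.length = d) :
    (wordSum L D).IsHomogeneous d := by
  induction L generalizing D d with
  | nil =>
    rw [wordSum]
    split_ifs with h
    · rw [← hD _ h]
      exact isHomogeneous_one _ _
    · exact isHomogeneous_zero _ _ _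
  | cons p L ih =>
    rw [wordSum]
    have hL' : ∀ p ∈ L, p.2.IsHomogeneous 1 := fun q hq => hL q (List.mem_cons_of_mem _ hq)
    refine (ih hL' hD).add ?_
    -- For `d = 0` no word of `D` has a first letter, so the second summand vanishes.
    cases d with
    | zero =>
      have : {w | p.1 :: w ∈ D} = (∅ : Set (List ℕ)) := by
        ext w
        simp only [Set.mem_ofPred_eq, Set.mem_empty_iff_false, iff_false]
        intro hw
        simpa using hD _ hw
      rw [this, wordSum_empty, mul_zero]
      exact isHomogeneous_zero _ _ _
    | succ d =>
      rw [add_comm d 1]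
      refine (hL p (by simp)).mul (ih hL' fun w hw => ?_)
      simpa using hD _ hw

/-! ### The long word -/

/-- The unbarred letters `n - 1, …, k` with weights `y - t_j`. -/
noncomputable def descending (k n : ℕ) (y : Pol) : List (ℕ × Pol) :=
  (List.Ico k n).reverse.map fun j => (j, y - t j)

/-- The barred letters `k, …, n - 1` with weights `t_j - z`. -/
noncomputable def ascending (k n : ℕ) (z : Pol) : List (ℕ × Pol) :=
  (List.Ico k n).map fun j => (j, t j - z)

/-- The `k`-th syllable of the long word, the variable `x_k` being replaced by `y`. -/
noncomputable def weightedSyllable (n k : ℕ) (y : Pol) : List (ℕ × Pol) :=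
  descending k n y ++ ascending (k + 1) n (t k)

/-- The long word as a list of values and weights. -/
noncomputable def weightedWord (n : ℕ) : List (ℕ × Pol) :=
  (List.Ico 0 n).flatMap fun k => weightedSyllable n k (x k)

theorem subwordSum_longWord (n : ℕ) (D : Set (List ℕ)) :
    subwordSum Letter.value letterWeight (longWord n) D = wordSum (weightedWord n) D := by
  rw [subwordSum_eq_wordSum, longWord, weightedWord, List.map_flatMap, List.Ico.zero_bot]
  congr 2
  funext k
  simp [syllable, weightedSyllable, descending, ascending, letterWeight, Function.comp_def]

theorem descending_eq {k n : ℕ} (h : k < n) (y : Pol) :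
    descending k n y = descending (k + 1) n y ++ [(k, y - t k)] := by
  simp [descending, List.Ico.eq_cons h]

/-! ### Cancellation in the long word under specialization -/

theorem wordSum_descending_ascending (L₁ L₂ : List (ℕ × Pol)) (k n : ℕ) (z : Pol)
    {D : Set (List ℕ)} (h : ∀ w ∈ D, w.Nodup) :
    wordSum (L₁ ++ (descending k n z ++ (ascending k n z ++ L₂))) D = wordSum (L₁ ++ L₂) D := by
  have := wordSum_cancel L₁ L₂ ((List.Ico k n).map fun j => (j, z - t j)) h
  simpa [descending, ascending, Function.comp_def] using this

theorem wordSum_ascending_descending (L₁ L₂ : List (ℕ × Pol)) (k n : ℕ) (z : Pol)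
    {D : Set (List ℕ)} (h : ∀ w ∈ D, w.Nodup) :
    wordSum (L₁ ++ (ascending k n z ++ (descending k n z ++ L₂))) D = wordSum (L₁ ++ L₂) D := by
  have := wordSum_cancel L₁ L₂ ((List.Ico k n).reverse.map fun j => (j, t j - z)) h
  simpa [descending, ascending, Function.comp_def] using this

/-- The letter `k` gets weight zero, and the unbarred letters above it then cancel against the
barred ones. -/
theorem wordSum_weightedSyllable_self (L₁ L₂ : List (ℕ × Pol)) (n k : ℕ)
    {D : Set (List ℕ)} (h : ∀ w ∈ D, w.Nodup) :
    wordSum (L₁ ++ (weightedSyllable n k (t k) ++ L₂)) D = wordSum (L₁ ++ L₂) D := by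
  by_cases hk : k < n
  · rw [weightedSyllable, descending_eq hk, sub_self]
    have := wordSum_zero_weight (L₁ ++ descending (k + 1) n (t k))
      (ascending (k + 1) n (t k) ++ L₂) k D
    simp only [List.append_assoc, List.cons_append, List.nil_append] at this ⊢
    rw [this, wordSum_descending_ascending _ _ _ _ _ h]
  · have h1 : List.Ico k n = [] := List.Ico.eq_nil_of_le (by omega)
    have h2 : List.Ico (k + 1) n = [] := List.Ico.eq_nil_of_le (by omega)
    simp [weightedSyllable, descending, ascending, h1, h2]

theorem map_weightedSyllable (φ : Pol →ₐ[ℤ] Pol) (hφ : ∀ j, φ (t j) = t j) (n k : ℕ) (y : Pol) :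
    (weightedSyllable n k y).map (Prod.map id φ) = weightedSyllable n k (φ y) := by
  simp [weightedSyllable, descending, ascending, Function.comp_def, hφ]

theorem map_flatMap_weightedSyllable (φ : Pol →ₐ[ℤ] Pol) (hφ : ∀ j, φ (t j) = t j) (n : ℕ)
    (l : List ℕ) (y : ℕ → Pol) :
    (l.flatMap fun k => weightedSyllable n k (y k)).map (Prod.map id φ) =
      l.flatMap fun k => weightedSyllable n k (φ (y k)) := by
  simp only [List.map_flatMap, map_weightedSyllable φ hφ]

theorem subst_t_wordSum (n : ℕ) {D : Set (List ℕ)} (h : ∀ w ∈ D, w.Nodup) :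
    subst t t (wordSum (weightedWord n) D) = wordSum [] D := by
  have e := wordSum_map (subst t t) id (weightedWord n) D
  rw [List.map_id_fun, Set.preimage_id] at e
  rw [← e, weightedWord, map_flatMap_weightedSyllable _ (subst_t t t)]
  simp only [subst_x]
  generalize List.Ico 0 n = l
  induction l with
  | nil => rfl
  | cons k l ih =>
    rw [List.flatMap_cons, ← List.nil_append (_ ++ _), wordSum_weightedSyllable_self _ _ _ _ h,
      List.nil_append, ih]

theorem weightedWord_eq {n i : ℕ} (h : i < n) :
    weightedWord n = ((List.Ico 0 i).flatMap fun k => weightedSyllable n k (x k)) ++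
      (weightedSyllable n i (x i) ++ (weightedSyllable n (i + 1) (x (i + 1)) ++
        ((List.Ico (i + 2) n).flatMap fun k => weightedSyllable n k (x k)))) := by
  rw [weightedWord, ← List.Ico.append_consecutive (Nat.zero_le i) h.le, List.flatMap_append,
    List.Ico.eq_cons h, List.flatMap_cons]
  by_cases h' : i + 1 < n
  · rw [List.Ico.eq_cons h', List.flatMap_cons]
  -- Here syllable `i + 1` lies beyond the word, but it is empty.
  · obtain rfl : n = i + 1 := by omega
    have : List.Ico (i + 2) (i + 1) = [] := List.Ico.eq_nil_of_le (by omega)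
    simp [weightedSyllable, descending, ascending, this]

/-- The long word after the `i`-th trimming operation, except for the letter `i` that it
extracts. -/
noncomputable def trimmedWord (n i : ℕ) : List (ℕ × Pol) :=
  (((List.Ico 0 i).flatMap fun k => weightedSyllable n k (x k)) ++ descending (i + 1) n (x i)) ++
    (ascending (i + 2) n (t (i + 1)) ++
      (List.Ico (i + 2) n).flatMap fun k => weightedSyllable n k (x (k - 1)))

theorem flatMap_weightedSyllable_congr {l : List ℕ} {n : ℕ} {y z : ℕ → Pol}
    (h : ∀ k ∈ l, y k = z k) :
    (l.flatMap fun k => weightedSyllable n k (y k)) =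
      l.flatMap fun k => weightedSyllable n k (z k) := by
  rw [List.flatMap, List.flatMap, List.map_congr_left fun k hk => by rw [h k hk]]

/-- Syllable `i` is evaluated at `t_i` and disappears; syllable `i + 1` takes over the variable
`x_i`. -/
theorem ropeMinus_wordSum {n i : ℕ} (hi : i < n) {D : Set (List ℕ)} (h : ∀ w ∈ D, w.Nodup) :
    ropeMinus i (wordSum (weightedWord n) D) = wordSum (trimmedWord n i) D := by
  have e := wordSum_map (ropeMinus i) id (weightedWord n) D
  rw [List.map_id_fun, Set.preimage_id] at e
  have ht : ∀ j, ropeMinus i (t j) = t j := fun j => subst_t _ _ j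
  have hA : ∀ k ∈ List.Ico 0 i, ropeMinus i (x k) = x k := by
    intro k hk
    rw [ropeMinus, subst_x, if_pos (List.Ico.mem.1 hk).2]
  have hC : ∀ k ∈ List.Ico (i + 2) n, ropeMinus i (x k) = x (k - 1) := by
    intro k hk
    have := List.Ico.mem.1 hk
    rw [ropeMinus, subst_x, if_neg (by omega), if_neg (by omega)]
  have h1 : ropeMinus i (x i) = t i := by simp [ropeMinus, subst_x]
  have h2 : ropeMinus i (x (i + 1)) = x i := by simp [ropeMinus, subst_x]
  rw [← e, weightedWord_eq hi, List.map_append, List.map_append, List.map_append,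
    map_flatMap_weightedSyllable _ ht, map_flatMap_weightedSyllable _ ht,
    map_weightedSyllable _ ht, map_weightedSyllable _ ht, h1, h2,
    flatMap_weightedSyllable_congr hA, flatMap_weightedSyllable_congr hC,
    wordSum_weightedSyllable_self _ _ _ _ h]
  simp only [trimmedWord, weightedSyllable, List.append_assoc]

/-- Syllable `i + 1` is evaluated at `t_i`, so its unbarred letters cancel the barred letters of
syllable `i`. What remains is the trimmed word with one extra letter `i`, of weight `x_i - t_i`, at
the junction. -/
theorem ropePlus_wordSum {n i : ℕ} (hi : i < n) {D D' : Set (List ℕ)} (h : ∀ w ∈ D, w.Nodup)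
    (hD : ∀ u v, (∀ b ∈ v, i + 2 ≤ b) → (u ++ i :: v ∈ D ↔ u ++ v ∈ D')) :
    ropePlus i (wordSum (weightedWord n) D) =
      wordSum (trimmedWord n i) D + (x i - t i) * wordSum (trimmedWord n i) D' := by
  have e := wordSum_map (ropePlus i) id (weightedWord n) D
  rw [List.map_id_fun, Set.preimage_id] at e
  have ht : ∀ j, ropePlus i (t j) = t j := fun j => subst_t _ _ j
  have hA : ∀ k ∈ List.Ico 0 i, ropePlus i (x k) = x k := by
    intro k hk
    rw [ropePlus, subst_x, if_pos (List.Ico.mem.1 hk).2.le]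
  have hC : ∀ k ∈ List.Ico (i + 2) n, ropePlus i (x k) = x (k - 1) := by
    intro k hk
    have := List.Ico.mem.1 hk
    rw [ropePlus, subst_x, if_neg (by omega), if_neg (by omega)]
  have h1 : ropePlus i (x i) = x i := by simp [ropePlus, subst_x]
  have h2 : ropePlus i (x (i + 1)) = t i := by simp [ropePlus, subst_x]
  rw [← e, weightedWord_eq hi, List.map_append, List.map_append, List.map_append,
    map_flatMap_weightedSyllable _ ht, map_flatMap_weightedSyllable _ ht,
    map_weightedSyllable _ ht, map_weightedSyllable _ ht, h1, h2,
    flatMap_weightedSyllable_congr hA, flatMap_weightedSyllable_congr hC]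
  have hcancel := wordSum_ascending_descending
    (((List.Ico 0 i).flatMap fun k => weightedSyllable n k (x k)) ++ descending i n (x i))
    (ascending (i + 2) n (t (i + 1)) ++
      (List.Ico (i + 2) n).flatMap fun k => weightedSyllable n k (x (k - 1))) (i + 1) n (t i) h
  have hins := wordSum_insert (p := (i, x i - t i)) (D := D) (D' := D')
    (L₁ := ((List.Ico 0 i).flatMap fun k => weightedSyllable n k (x k)) ++
      descending (i + 1) n (x i))
    (L₂ := ascending (i + 2) n (t (i + 1)) ++
      (List.Ico (i + 2) n).flatMap fun k => weightedSyllable n k (x (k - 1))) (by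
    refine fun u v hv => hD u v fun b hb => ?_
    have := hv b hb
    simp only [weightedSyllable, descending, ascending, List.map_append, List.map_map,
      List.mem_append, List.mem_map, List.mem_flatMap, List.mem_reverse,
      List.Ico.mem, Function.comp_apply, List.map_flatMap] at this
    grind)
  rw [trimmedWord, ← hins]
  rw [descending_eq hi] at hcancel
  simp only [weightedSyllable, descending_eq hi (x i), List.append_assoc, List.cons_append,
    List.nil_append] at hcancel ⊢
  exact hcancel

theorem eope_wordSum {n i : ℕ} (hi : i < n) {D D' : Set (List ℕ)} (h : ∀ w ∈ D, w.Nodup)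
    (hD : ∀ u v, (∀ b ∈ v, i + 2 ≤ b) → (u ++ i :: v ∈ D ↔ u ++ v ∈ D')) :
    eope i (wordSum (weightedWord n) D) = wordSum (trimmedWord n i) D' := by
  apply mul_left_cancel₀ (x_sub_t_ne_zero i)
  rw [mul_eope, ropePlus_wordSum hi h hD, ropeMinus_wordSum hi h]
  ring

/-- Only the variables `x_k` with `k < n ≤ i` occur, and both substitutions fix them. -/
theorem eope_wordSum_of_le {n i : ℕ} (hi : n ≤ i) (D : Set (List ℕ)) :
    eope i (wordSum (weightedWord n) D) = 0 := by
  apply mul_left_cancel₀ (x_sub_t_ne_zero i)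
  rw [mul_eope, mul_zero, sub_eq_zero]
  have e₁ := wordSum_map (ropePlus i) id (weightedWord n) D
  have e₂ := wordSum_map (ropeMinus i) id (weightedWord n) D
  rw [List.map_id_fun, Set.preimage_id] at e₁ e₂
  rw [← e₁, ← e₂, weightedWord, map_flatMap_weightedSyllable (ropePlus i) fun j => subst_t _ _ j,
    map_flatMap_weightedSyllable (ropeMinus i) fun j => subst_t _ _ j]
  congr 1
  apply flatMap_weightedSyllable_congr
  intro k hk
  have := List.Ico.mem.1 hk
  rw [ropePlus, ropeMinus, subst_x, subst_x, if_pos (by omega), if_pos (by omega)]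

/-! ### Relabelling the trimmed word -/

theorem filter_Ico_succ_of_le {i k m : ℕ} (hk : k ≤ i) (hi : i ≤ m) :
    (List.Ico k (m + 1)).filter (fun j => j ≠ i) = (List.Ico k m).map (skipAt i) := by
  rw [← List.Ico.append_consecutive hk (show i ≤ m + 1 by omega),
    List.Ico.eq_cons (show i < m + 1 by omega), ← List.Ico.append_consecutive hk hi,
    List.filter_append, List.filter_cons_of_neg (by simp), List.map_append,
    ← List.Ico.map_add i m 1]
  congr 1
  · rw [List.filter_eq_self.2 fun a ha => by have := List.Ico.mem.1 ha; simp; omega]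
    conv_lhs => rw [← List.map_id (List.Ico k i)]
    exact List.map_congr_left fun a ha => (if_pos (List.Ico.mem.1 ha).2).symm
  · rw [List.filter_eq_self.2]
    · refine List.map_congr_left fun a ha => ?_
      have := List.Ico.mem.1 ha
      rw [skipAt, if_neg (by omega), add_comm]
    · intro a ha
      obtain ⟨b, hb, rfl⟩ := List.mem_map.1 ha
      have := List.Ico.mem.1 hb
      simp; omega

theorem filter_Ico_succ_of_ge {i k m : ℕ} (hk : i ≤ k) :
    (List.Ico (k + 1) (m + 1)).filter (fun j => j ≠ i) = (List.Ico k m).map (skipAt i) := by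
  rw [← List.Ico.map_add k m 1, List.filter_eq_self.2]
  · refine List.map_congr_left fun a ha => ?_
    have := List.Ico.mem.1 ha
    rw [skipAt, if_neg (by omega), add_comm]
  · intro a ha
    obtain ⟨b, hb, rfl⟩ := List.mem_map.1 ha
    have := List.Ico.mem.1 hb
    simp; omega

theorem subst_tHat_t (i j : ℕ) : subst x (tHat i) (t j) = t (skipAt i j) := by
  rw [subst_t, tHat, skipAt]
  split_ifs <;> rfl

theorem filter_descending {i k k' m : ℕ} (y : Pol)
    (h : (List.Ico k' (m + 1)).filter (fun j => j ≠ i) = (List.Ico k m).map (skipAt i)) :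
    (descending k' (m + 1) (subst x (tHat i) y)).filter (fun p => p.1 ≠ i) =
      (descending k m y).map (Prod.map (skipAt i) (subst x (tHat i))) := by
  rw [descending, List.filter_map, List.filter_reverse]
  simp only [Function.comp_def]
  rw [h]
  simp [descending, Function.comp_def, subst_tHat_t]

theorem filter_ascending {i k k' m : ℕ} (y : Pol)
    (h : (List.Ico k' (m + 1)).filter (fun j => j ≠ i) = (List.Ico k m).map (skipAt i)) :
    (ascending k' (m + 1) (subst x (tHat i) y)).filter (fun p => p.1 ≠ i) =
      (ascending k m y).map (Prod.map (skipAt i) (subst x (tHat i))) := by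
  rw [ascending, List.filter_map]
  simp only [Function.comp_def]
  rw [h]
  simp [ascending, Function.comp_def, subst_tHat_t]

/-- Syllables before `i` keep their index, the merged syllable becomes syllable `i`, and each later
syllable `k` becomes syllable `k - 1`, whose variable it already carries. -/
theorem filter_trimmedWord {m i : ℕ} (hi : i ≤ m) :
    (trimmedWord (m + 1) i).filter (fun p => p.1 ≠ i) =
      (weightedWord m).map (Prod.map (skipAt i) (subst x (tHat i))) := by
  have hlow : ∀ k ∈ List.Ico 0 i, (weightedSyllable (m + 1) k (x k)).filter (fun p => p.1 ≠ i) =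
      (weightedSyllable m k (x k)).map (Prod.map (skipAt i) (subst x (tHat i))) := by
    intro k hk
    have hk := (List.Ico.mem.1 hk).2
    have h1 := filter_descending (x k) (filter_Ico_succ_of_le hk.le hi)
    have h2 := filter_ascending (t k) (filter_Ico_succ_of_le (show k + 1 ≤ i from hk) hi)
    rw [subst_x] at h1
    rw [subst_tHat_t, skipAt, if_pos hk] at h2
    rw [weightedSyllable, List.filter_append, h1, h2, weightedSyllable, List.map_append]
  -- For `k = i` this is the merged syllable, for `k > i` syllable `k + 1` with variable `x_k`;
  -- neither contains the letter `i`.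
  have hhigh : ∀ k, i ≤ k → (descending (k + 1) (m + 1) (x k) ++
      ascending (k + 2) (m + 1) (t (k + 1))).filter (fun p => p.1 ≠ i) =
      (weightedSyllable m k (x k)).map (Prod.map (skipAt i) (subst x (tHat i))) := by
    intro k hk
    have h1 := filter_descending (x k) (filter_Ico_succ_of_ge (m := m) hk)
    have h2 := filter_ascending (t k)
      (filter_Ico_succ_of_ge (m := m) (show i ≤ k + 1 by omega))
    rw [subst_x] at h1
    rw [subst_tHat_t, skipAt, if_neg (by omega)] at h2
    rw [List.filter_append, h1, h2, weightedSyllable, List.map_append]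
  have hword : weightedWord m = ((List.Ico 0 i).flatMap fun k => weightedSyllable m k (x k)) ++
      (weightedSyllable m i (x i) ++
        ((List.Ico (i + 1) m).flatMap fun k => weightedSyllable m k (x k))) := by
    rw [weightedWord, ← List.Ico.append_consecutive (Nat.zero_le i) hi, List.flatMap_append]
    by_cases h : i < m
    · rw [List.Ico.eq_cons h, List.flatMap_cons]
    · obtain rfl : m = i := by omega
      have : List.Ico (m + 1) m = [] := List.Ico.eq_nil_of_le (by omega)
      simp [weightedSyllable, descending, ascending, this]
  rw [hword, trimmedWord, List.append_assoc, ← List.append_assoc (descending _ _ _),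
    List.filter_append, List.filter_append, hhigh i le_rfl, List.map_append, List.map_append]
  congr 1
  · rw [List.filter_flatMap, List.map_flatMap]
    simp only [List.flatMap]
    rw [List.map_congr_left hlow]
  · congr 1
    rw [← List.Ico.map_add (i + 1) m 1, List.filter_flatMap, List.map_flatMap]
    simp only [List.flatMap, List.map_map]
    congr 1
    refine List.map_congr_left fun k hk => ?_
    have hk := List.Ico.mem.1 hk
    rw [← hhigh k (by omega)]
    simp [weightedSyllable, add_comm 1 k]

/-! ### The recursion for subword sums of Sylvester words -/

open Classical in
theorem eope_wordSum_sylvester {m i : ℕ} (hi : i ≤ m) (F : IndexedForest) :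
    eope i (wordSum (weightedWord (m + 1)) F.sylvester) =
      if i ∈ F.qdes then subst x (tHat i) (wordSum (weightedWord m) (F.trim i).sylvester)
      else 0 := by
  split_ifs with h
  · rw [eope_wordSum (by omega) (fun w hw => hw.1)
      (D' := List.map (skipAt i) '' (F.trim i).sylvester)]
    · rw [← wordSum_filter_ne (i := i), filter_trimmedWord hi, wordSum_map,
        Set.preimage_image_eq _ (List.map_injective_iff.2 (skipAt_injective i))]
      rintro _ ⟨w, -, rfl⟩ hw
      obtain ⟨a, -, ha⟩ := List.mem_map.1 hw
      exact skipAt_ne i a ha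
    · intro u v hv
      constructor
      · intro huv
        have hnd := huv.1
        rw [List.nodup_middle, List.nodup_cons] at hnd
        -- Since `i` occurs only once, `u ++ v` avoids it and can be relabelled.
        obtain ⟨w, hw⟩ : ∃ w : List ℕ, w.map (skipAt i) = u ++ v := by
          have : u ++ v ∈ Set.range (List.map (skipAt i)) := by
            rw [Set.range_list_map]
            intro a ha
            exact exists_skipAt_eq fun e => hnd.1 (e ▸ ha)
          exact this
        exact ⟨w, (insert_mem_sylvester_iff h hv hw.symm).1 huv, hw⟩
      · rintro ⟨w, hw, e⟩
        exact (insert_mem_sylvester_iff h hv e.symm).2 hw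
  · rw [eope_wordSum (by omega) (fun w hw => hw.1) (D' := ∅), wordSum_empty]
    intro u v hv
    simp only [Set.mem_empty_iff_false, iff_false]
    exact fun huv => h (mem_qdes_of_insert_mem_sylvester hv huv)

open Classical in
theorem subst_t_wordSum_sylvester (n : ℕ) (F : IndexedForest) :
    subst t t (wordSum (weightedWord n) F.sylvester) = if F = IndexedForest.empty then 1 else 0 := by
  rw [subst_t_wordSum n fun w hw => hw.1, wordSum]
  simp only [nil_mem_sylvester_iff]

theorem eope_sub (i : ℕ) (f g : Pol) : eope i (f - g) = eope i f - eope i g := by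
  apply mul_left_cancel₀ (x_sub_t_ne_zero i)
  rw [mul_sub, mul_eope, mul_eope, mul_eope, map_sub, map_sub]
  ring

theorem eq_of_eope_eq {f g : Pol} (h : ∀ i, eope i f = eope i g)
    (h0 : subst t t f = subst t t g) : f = g := by
  rw [← sub_eq_zero]
  apply eq_zero_of_eope_eq_zero
  · intro i
    rw [eope_sub, h, sub_self]
  · rw [map_sub, h0, sub_self]

theorem eope_wordSum_sylvester_of_notMem {n i : ℕ} {F : IndexedForest} (hi : i ∉ F.qdes) :
    eope i (wordSum (weightedWord n) F.sylvester) = 0 := by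
  rcases lt_or_ge i n with h | h
  · obtain ⟨n, rfl⟩ := Nat.exists_eq_succ_of_ne_zero (show n ≠ 0 by omega)
    rw [eope_wordSum_sylvester (by omega), if_neg hi]
  · exact eope_wordSum_of_le h _

/-- Both sides have the same trimmings, by induction, and the same value at `x = t`; hence the size
of the long word does not matter. -/
theorem wordSum_sylvester_eq {n m : ℕ} {F : IndexedForest} (hn : F.support ⊆ Set.Iio (n + 1))
    (hm : F.support ⊆ Set.Iio (m + 1)) :
    wordSum (weightedWord n) F.sylvester = wordSum (weightedWord m) F.sylvester := by
  induction n generalizing m F with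
  | zero =>
    refine eq_of_eope_eq (fun i => ?_) ?_
    · have hi : i ∉ F.qdes := fun hi => absurd (lt_of_mem_qdes hn hi) (Nat.not_lt_zero i)
      rw [eope_wordSum_sylvester_of_notMem hi, eope_wordSum_sylvester_of_notMem hi]
    · rw [subst_t_wordSum_sylvester, subst_t_wordSum_sylvester]
  | succ n ih =>
    refine eq_of_eope_eq (fun i => ?_) ?_
    · by_cases hi : i ∈ F.qdes
      · have h1 := lt_of_mem_qdes hn hi
        have h2 := lt_of_mem_qdes hm hi
        obtain ⟨m, rfl⟩ := Nat.exists_eq_succ_of_ne_zero (show m ≠ 0 by omega)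
        rw [eope_wordSum_sylvester (by omega), eope_wordSum_sylvester (by omega), if_pos hi,
          if_pos hi, ih (support_trim_subset hn hi) (support_trim_subset hm hi)]
      · rw [eope_wordSum_sylvester_of_notMem hi, eope_wordSum_sylvester_of_notMem hi]
    · rw [subst_t_wordSum_sylvester, subst_t_wordSum_sylvester]

/-! ### Double forest polynomials -/

/-- The double forest polynomial of `F`, by the subword model of any sufficient size. -/
noncomputable def doubleForest (F : IndexedForest) : Pol :=
  wordSum (weightedWord (Classical.choose F.exists_support_subset)) F.sylvester

theorem doubleForest_eq {n : ℕ} {F : IndexedForest} (h : F.support ⊆ Set.Iio (n + 1)) :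
    doubleForest F = wordSum (weightedWord n) F.sylvester :=
  wordSum_sylvester_eq (Classical.choose_spec F.exists_support_subset) h

theorem isHomogeneous_of_mem_weightedWord {n : ℕ} {p : ℕ × Pol} (hp : p ∈ weightedWord n) :
    p.2.IsHomogeneous 1 := by
  simp only [weightedWord, weightedSyllable, descending, ascending, List.mem_flatMap,
    List.mem_append, List.mem_map] at hp
  obtain ⟨k, -, ⟨j, -, rfl⟩ | ⟨j, -, rfl⟩⟩ := hp
  · exact (isHomogeneous_X _ _).sub (isHomogeneous_X _ _)
  · exact (isHomogeneous_X _ _).sub (isHomogeneous_X _ _)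

theorem isDoubleForestFamily_doubleForest : IsDoubleForestFamily doubleForest where
  homogeneous F := by
    by_cases h : ∃ w, w ∈ F.sylvester
    · obtain ⟨w, hw⟩ := h
      exact ⟨w.length, wordSum_isHomogeneous (fun _ => isHomogeneous_of_mem_weightedWord)
        fun _ hw' => length_eq_of_mem_sylvester hw' hw⟩
    -- This case spares a proof that Sylvester words exist: over no words, any degree serves.
    · exact ⟨0, wordSum_isHomogeneous (fun _ => isHomogeneous_of_mem_weightedWord)
        fun w hw => absurd ⟨w, hw⟩ h⟩
  normalized F := subst_t_wordSum_sylvester _ F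
  recursion F i := by
    split_ifs with hi
    · obtain ⟨n, hn⟩ := F.exists_support_subset
      obtain ⟨n, rfl⟩ := Nat.exists_eq_succ_of_ne_zero
        (show n ≠ 0 from (Nat.zero_le i |>.trans_lt (lt_of_mem_qdes hn hi)).ne')
      have := lt_of_mem_qdes hn hi
      rw [doubleForest_eq hn, doubleForest_eq (support_trim_subset hn hi),
        eope_wordSum_sylvester (by omega), if_pos hi]
    · exact eope_wordSum_sylvester_of_notMem hi

theorem IsDoubleForestFamily.eq {P Q : IndexedForest → Pol} (hP : IsDoubleForestFamily P)
    (hQ : IsDoubleForestFamily Q) : P = Q := by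
  have key : ∀ (n : ℕ) (F : IndexedForest), F.support ⊆ Set.Iio (n + 1) → P F = Q F := by
    intro n
    induction n with
    | zero =>
      intro F hF
      refine eq_of_eope_eq (fun i => ?_) (by rw [hP.normalized, hQ.normalized])
      have hi : i ∉ F.qdes := fun hi => absurd (lt_of_mem_qdes hF hi) (Nat.not_lt_zero i)
      rw [hP.recursion, hQ.recursion, if_neg hi, if_neg hi]
    | succ n ih =>
      intro F hF
      refine eq_of_eope_eq (fun i => ?_) (by rw [hP.normalized, hQ.normalized])
      rw [hP.recursion, hQ.recursion]
      split_ifs with hi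
      · rw [ih _ (support_trim_subset hF hi)]
      · rfl
  funext F
  obtain ⟨n, hn⟩ := F.exists_support_subset
  exact key n F hn

end DoubleForest

open DoubleForest in
theorem theorem4p2 :
    (∃! P : IndexedForest → Pol, IsDoubleForestFamily P) ∧
      ∀ P : IndexedForest → Pol, IsDoubleForestFamily P →
        ∀ (n : ℕ) (F : IndexedForest), F.support ⊆ Set.Iio (n + 1) →
          P F = subwordSum Letter.value letterWeight (longWord n) F.sylvester := by
  refine ⟨⟨doubleForest, isDoubleForestFamily_doubleForest,
    fun P hP => hP.eq isDoubleForestFamily_doubleForest⟩, ?_⟩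
  intro P hP n F hF
  rw [hP.eq isDoubleForestFamily_doubleForest, doubleForest_eq hF, subwordSum_longWord]
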